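/- Theorem (Borell–Brunn–Minkowski inequality). Let $f,g,h:\mathbb R^n\to[0,+\infty)$ be (Lebesgue) measurable functions, write $\mathrm{supp}(f)=\{x: f(x)\neq 0\}$, and suppose that $\mathrm{supp}(f)$ and $\mathrm{supp}(g)$ are nonempty. For $k=1,\dots,n$ let $P_k=\{x_k : x\in\mathrm{supp}(f)\}$ and $Q_k=\{y_k : y\in\mathrm{supp}(g)\}$, and let $\varphi=(\varphi_1,\dots,\varphi_n):\mathrm{supp}(f)\times\mathrm{supp}(g)\to\mathbb R^n$ be coordinatewise, $\varphi_k(x,y)=\varphi_k(x_k,y_k)$, where each $\varphi_k:P_k\times Q_k\to\mathbb R$ is continuously differentiable with positive partial derivatives and is strictly increasing in each of its two variables (the monotonicity is automatic from the positivity of the partial derivatives if $P_k$ and $Q_k$ are intervals). Here continuous differentiability on $P_k\times Q_k$ means that there are continuous functions $\frac{\partial\varphi_k}{\partial x_k},\frac{\partial\varphi_k}{\partial y_k}$ on $P_k\times Q_k$ such that, at each point of $P_k\times Q_k$, $\varphi_k$ is differentiable relative to $P_k\times Q_k$ with differential $\frac{\partial\varphi_k}{\partial x_k}\,dx_k+\frac{\partial\varphi_k}{\partial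 y_k}\,dy_k$; where such functions are not unique (e.g. at isolated points), any choice of positive ones is allowed and fixed. Let $\Phi:[0,+\infty)\times[0,+\infty)\to[0,+\infty)$ be continuous, homogeneous of degree $1$ and nondecreasing in each variable. If $$h(\varphi(x,y))\prod_{k=1}^n\left(\frac{\partial\varphi_k}{\partial x_k}(x_k,y_k)\,\rho_k+\frac{\partial\varphi_k}{\partial y_k}(x_k,y_k)\,\eta_k\right)\ \ge\ \Phi\left(f(x)\prod_{k=1}^n\rho_k,\ g(y)\prod_{k=1}^n\eta_k\right)$$ for every $x\in\mathrm{supp}(f)$, every $y\in\mathrm{supp}(g)$ and all $\rho_1,\dots,\rho_n>0$, $\eta_1,\dots,\eta_n>0$, then $$\int_{\mathbb R^n} h\ \ge\ \Phi\left(\int_{\mathbb R^n} f,\ \int_{\mathbb R^n} g\right).$$ The integrals take values in $[0,+\infty]$, and for infinite arguments $\Phi$ is extended by monotone limits: $\Phi(a,b)=\sup\{\Phi(s,t): s,t\in[0,+\infty),\ s\le a,\ t\le b\}$. -/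

import Mathlib

open MeasureTheory
open scoped NNReal ENNReal

/-- The set of values taken by the `k`-th coordinate on `supp f = {x | f x ≠ 0}`. -/
def coordSupport {n : ℕ} (f : (Fin n → ℝ) → ℝ≥0) (k : Fin n) : Set ℝ :=
  (fun x : Fin n → ℝ => x k) '' Function.support f

/-- `φ` is a continuously differentiable function of two real variables on `P ×ˢ Q`
(an arbitrary, not necessarily open, product set), with positive partial derivatives
`φx = ∂φ/∂x` and `φy = ∂φ/∂y`, and it is strictly increasing in each variable on `P ×ˢ Q`.
If `P` and `Q` are intervals, the last two fields follow from the others; for sets with gaps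
positivity of the derivatives does not control the increments of `φ` across a gap. -/
structure IsIncreasingC1On (φ φx φy : ℝ × ℝ → ℝ) (P Q : Set ℝ) : Prop where
  hasFDerivWithinAt : ∀ p ∈ P ×ˢ Q, HasFDerivWithinAt φ
    (φx p • ContinuousLinearMap.fst ℝ ℝ ℝ + φy p • ContinuousLinearMap.snd ℝ ℝ ℝ) (P ×ˢ Q) p
  continuousOn_fst : ContinuousOn φx (P ×ˢ Q)
  continuousOn_snd : ContinuousOn φy (P ×ˢ Q)
  fst_pos : ∀ p ∈ P ×ˢ Q, 0 < φx p
  snd_pos : ∀ p ∈ P ×ˢ Q, 0 < φy p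
  strictMono_fst : ∀ y ∈ Q, StrictMonoOn (fun x => φ (x, y)) P
  strictMono_snd : ∀ x ∈ P, StrictMonoOn (fun y => φ (x, y)) Q

/-- The extension of `Φ : [0,∞)² → [0,∞)` to `[0,∞]²` by monotone limits (it agrees with a
nondecreasing `Φ` at finite arguments, see `extendTop_coe`). -/
noncomputable def extendTop (Φ : ℝ≥0 → ℝ≥0 → ℝ≥0) (a b : ℝ≥0∞) : ℝ≥0∞ :=
  ⨆ (s : ℝ≥0) (t : ℝ≥0) (_ : (s : ℝ≥0∞) ≤ a) (_ : (t : ℝ≥0∞) ≤ b), (Φ s t : ℝ≥0∞)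

theorem extendTop_coe {Φ : ℝ≥0 → ℝ≥0 → ℝ≥0} (h₁ : ∀ b, Monotone fun a => Φ a b)
    (h₂ : ∀ a, Monotone (Φ a)) (a b : ℝ≥0) :
    extendTop Φ (a : ℝ≥0∞) (b : ℝ≥0∞) = (Φ a b : ℝ≥0∞) := by
  apply le_antisymm
  · refine iSup₂_le fun s t => iSup₂_le fun hs ht => ?_
    rw [ENNReal.coe_le_coe] at hs ht ⊢
    exact (h₁ t hs).trans (h₂ a ht)
  · exact le_iSup₂_of_le a b (le_iSup₂_of_le le_rfl le_rfl le_rfl)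

open Set Filter Topology

/-! The proof is by transport, first for densities with finite nonzero integrals F, G. On the line,
let u, v be their quantile functions on [0,1], so that u' = F/f(u) and v' = G/g(v)
(`exists_quantile`). With z = φ(u, v), the hypothesis at ρ = u', η = v' reads h(z) z' ≥ Φ(F, G).
Since z is strictly increasing, integrating over t bounds ∫ h from below
(`lintegral_transport_real`).

In dimension n + 1 the line case is applied to the marginals, whose hypothesis is the n-dimensional
inequality for slices (`lintegral_transport_pi`).

In general, simple functions below f and g provide the finite nonzero integrals. If ∫ f or ∫ g
vanishes, one point of that support is fixed and its weights tend to 0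
(`const_mul_lintegral_le_of_coordinatewise`). -/

/-! ### Quantile functions on the line. -/

theorem Monotone.lt_of_hasDerivAt_pos {c : ℝ → ℝ} (hc : Monotone c) {c' x : ℝ}
    (h : HasDerivAt c c' x) (h0 : 0 < c') :
    (∀ y, x < y → c x < c y) ∧ ∀ y, y < x → c y < c x := by
  have h1 : ∀ᶠ y in 𝓝[≠] x, 0 < slope c x y := (hasDerivAt_iff_tendsto_slope.1 h).eventually_const_lt h0
  constructor
  · intro y hy
    have h2 : ∀ᶠ z in 𝓝[>] x, 0 < slope c x z := h1.filter_mono (nhdsWithin_mono _ fun z hz => ne_of_gt hz)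
    obtain ⟨z, hz, hxz, hzy⟩ := (h2.and (Ioo_mem_nhdsGT hy)).exists
    rw [slope_def_field, div_pos_iff_of_pos_right (sub_pos.2 hxz)] at hz
    linarith [hc hzy.le]
  · intro y hy
    have h2 : ∀ᶠ z in 𝓝[<] x, 0 < slope c x z := h1.filter_mono (nhdsWithin_mono _ fun z hz => ne_of_lt hz)
    obtain ⟨z, hz, hxz, hzy⟩ := (h2.and (Ioo_mem_nhdsLT hy)).exists
    rw [slope_comm, slope_def_field, div_pos_iff_of_pos_right (sub_pos.2 hzy)] at hz
    linarith [hc hxz.le]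

/-- A right inverse of a monotone function on the image of a set of points where its derivative is
positive. -/
theorem Monotone.exists_hasDerivWithinAt_rightInverse {c : ℝ → ℝ} (hc : Monotone c) {c' : ℝ → ℝ}
    {A : Set ℝ} (h : ∀ x ∈ A, HasDerivAt c (c' x) x) (h0 : ∀ x ∈ A, 0 < c' x) :
    StrictMonoOn c A ∧ ∃ u : ℝ → ℝ, (∀ t ∈ c '' A, u t ∈ A) ∧ StrictMonoOn u (c '' A) ∧
      ∀ t ∈ c '' A, HasDerivWithinAt u (c' (u t))⁻¹ (c '' A) t := by
  have hs : StrictMonoOn c A := fun x hx y _ hxy => (hc.lt_of_hasDerivAt_pos (h x hx) (h0 x hx)).1 y hxy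
  refine ⟨hs, Function.invFunOn c A, fun t ht => Function.invFunOn_mem ht, ?_, ?_⟩
  · rintro s ⟨x, hx, rfl⟩ t ⟨y, hy, rfl⟩ hst
    rw [hs.injOn.leftInvOn_invFunOn hx, hs.injOn.leftInvOn_invFunOn hy]
    exact (hs.lt_iff_lt hx hy).1 hst
  · rintro t ⟨x, hx, rfl⟩
    have hu : ∀ x ∈ A, Function.invFunOn c A (c x) = x := hs.injOn.leftInvOn_invFunOn
    -- For a < x one has c a < c x even when a is outside A, and c y > c a forces y > a; likewise on
    -- the right.
    have hcont : Tendsto (Function.invFunOn c A) (𝓝[c '' A] (c x)) (𝓝 x) := by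
      obtain ⟨hgt, hlt⟩ := hc.lt_of_hasDerivAt_pos (h x hx) (h0 x hx)
      refine tendsto_order.2 ⟨fun a ha => ?_, fun a ha => ?_⟩
      · filter_upwards [self_mem_nhdsWithin, mem_nhdsWithin_of_mem_nhds (Ioi_mem_nhds (hlt a ha))]
        rintro _ ⟨y, hy, rfl⟩ hya
        rw [hu y hy]
        exact hc.reflect_lt hya
      · filter_upwards [self_mem_nhdsWithin, mem_nhdsWithin_of_mem_nhds (Iio_mem_nhds (hgt a ha))]
        rintro _ ⟨y, hy, rfl⟩ hya
        rw [hu y hy]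
        exact hc.reflect_lt hya
    have hd' : HasDerivAt c (c' x) (Function.invFunOn c A (c x)) := by rw [hu x hx]; exact h x hx
    have hd := hd'.hasFDerivAt_equiv (h0 x hx).ne'
    have := (hd.hasFDerivWithinAt (s := univ)).of_local_left_inverse
      (g := Function.invFunOn c A) (s := c '' A) (a := c x) (by simpa [hu x hx] using hcont) ⟨x, hx, rfl⟩
      (by
        filter_upwards [self_mem_nhdsWithin]
        rintro _ ⟨y, hy, rfl⟩
        rw [hu y hy])
    rw [hasDerivWithinAt_iff_hasFDerivWithinAt, hu x hx]
    convert! this using 1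

/-- The quantile function of the probability density `f / ∫ f`. -/
theorem exists_quantile {f : ℝ → ℝ≥0} (hf : Measurable f) (h0 : ∫⁻ x, (f x : ℝ≥0∞) ≠ 0)
    (htop : ∫⁻ x, (f x : ℝ≥0∞) ≠ ∞) :
    ∃ (u : ℝ → ℝ) (S : Set ℝ), MeasurableSet S ∧ S ⊆ Icc 0 1 ∧ volume S = 1 ∧
      (∀ t ∈ S, f (u t) ≠ 0) ∧ StrictMonoOn u S ∧
      ∀ t ∈ S, HasDerivWithinAt u ((∫⁻ x, (f x : ℝ≥0∞)).toReal / f (u t)) S t := by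
  set F := (∫⁻ x, (f x : ℝ≥0∞)).toReal with hF
  have hFpos : 0 < F := ENNReal.toReal_pos h0 htop
  have hint : Integrable (fun x => (f x : ℝ)) := by
    refine ⟨hf.coe_nnreal_real.aestronglyMeasurable, ?_⟩
    simpa [hasFiniteIntegral_iff_enorm, NNReal.enorm_eq] using htop.lt_top
  have hFint : ∫ x, (f x : ℝ) = F := by
    rw [integral_eq_lintegral_of_nonneg_ae (ae_of_all _ fun x => (f x).coe_nonneg) hint.1]
    simp [hF]
  let c : ℝ → ℝ := fun x => (∫ t in Iic x, (f t : ℝ)) / F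
  have hc : Monotone c := fun x y hxy => by
    refine div_le_div_of_nonneg_right ?_ hFpos.le
    exact setIntegral_mono_set hint.integrableOn (ae_of_all _ fun x => (f x).coe_nonneg)
      (Iic_subset_Iic.2 hxy).eventuallyLE
  have hc01 : ∀ x, c x ∈ Icc (0 : ℝ) 1 := fun x => by
    refine ⟨div_nonneg (integral_nonneg fun x => (f x).coe_nonneg) hFpos.le, ?_⟩
    rw [div_le_one hFpos, ← hFint]
    exact setIntegral_le_integral hint (ae_of_all _ fun x => (f x).coe_nonneg)
  have hderiv : ∀ᵐ x, HasDerivAt c (f x / F) x := by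
    filter_upwards [LocallyIntegrable.ae_hasDerivAt_integral hint.locallyIntegrable] with x hx
    have : c = fun x => ((∫ t in Iic 0, (f t : ℝ)) + ∫ t in (0 : ℝ)..x, (f t : ℝ)) / F := by
      funext y
      rw [← intervalIntegral.integral_Iic_sub_Iic hint.integrableOn hint.integrableOn]
      simp [c]
    rw [this]
    exact ((hx 0).const_add _).div_const F
  obtain ⟨N, hN, hNm, hN0⟩ := exists_measurable_superset_of_null (ae_iff.1 hderiv)
  -- The points where the distribution function has derivative f/F and this is positive. They carry
  -- all the mass of f, so the image of A has measure 1.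
  let A : Set ℝ := Nᶜ ∩ f ⁻¹' {0}ᶜ
  have hA : MeasurableSet A := hNm.compl.inter (hf (measurableSet_singleton 0).compl)
  have hAd : ∀ x ∈ A, HasDerivAt c (f x / F) x := fun x hx => by
    by_contra hcon
    exact hx.1 (hN hcon)
  have hAf : ∀ x ∈ A, f x ≠ 0 := fun x hx => hx.2
  have hApos : ∀ x ∈ A, 0 < (f x : ℝ) / F := fun x hx =>
    div_pos (NNReal.coe_pos.2 (pos_iff_ne_zero.2 (hAf x hx))) hFpos
  obtain ⟨hs, u, huA, hu, hud⟩ := hc.exists_hasDerivWithinAt_rightInverse hAd hApos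
  have hvol := lintegral_image_eq_lintegral_abs_deriv_mul hA
    (fun x hx => (hAd x hx).hasDerivWithinAt) hs.injOn (fun _ => 1)
  refine ⟨u, c '' A, ?_, image_subset_iff.2 fun x _ => hc01 x, ?_, fun t ht => hAf _ (huA t ht), hu, ?_⟩
  · exact measurable_image_of_fderivWithin hA
      (fun x hx => (hAd x hx).hasFDerivAt.hasFDerivWithinAt) hs.injOn
  · simp only [lintegral_const, Measure.restrict_apply_univ, one_mul, mul_one] at hvol
    rw [hvol]
    have e1 : ∀ x, ENNReal.ofReal |(f x : ℝ) / F| = ENNReal.ofReal F⁻¹ * f x := fun x => by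
      rw [abs_of_nonneg (div_nonneg (f x).coe_nonneg hFpos.le), div_eq_inv_mul,
        ENNReal.ofReal_mul (inv_nonneg.2 hFpos.le), ENNReal.ofReal_coe_nnreal]
    simp_rw [e1]
    rw [lintegral_const_mul _ hf.coe_nnreal_ennreal]
    have e2 : ∫⁻ x in A, (f x : ℝ≥0∞) = ∫⁻ x, (f x : ℝ≥0∞) := by
      rw [← lintegral_indicator hA]
      refine lintegral_congr_ae ?_
      filter_upwards [measure_eq_zero_iff_ae_notMem.1 hN0] with x hx
      by_cases hfx : f x = 0
      · simp [indicator, hfx]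
      · rw [indicator_of_mem]
        exact ⟨hx, hfx⟩
    rw [e2, ← ENNReal.ofReal_toReal htop, ← hF, ← ENNReal.ofReal_mul (inv_nonneg.2 hFpos.le),
      inv_mul_cancel₀ hFpos.ne', ENNReal.ofReal_one]
  · intro t ht
    simpa only [inv_div] using hud t ht

/-! ### The inequality in dimension one. -/

theorem IsIncreasingC1On.mono {φ φx φy : ℝ × ℝ → ℝ} {P Q P' Q' : Set ℝ}
    (h : IsIncreasingC1On φ φx φy P Q) (hP : P' ⊆ P) (hQ : Q' ⊆ Q) :
    IsIncreasingC1On φ φx φy P' Q' where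
  hasFDerivWithinAt p hp :=
    (h.hasFDerivWithinAt p (prod_mono hP hQ hp)).mono (prod_mono hP hQ)
  continuousOn_fst := h.continuousOn_fst.mono (prod_mono hP hQ)
  continuousOn_snd := h.continuousOn_snd.mono (prod_mono hP hQ)
  fst_pos p hp := h.fst_pos p (prod_mono hP hQ hp)
  snd_pos p hp := h.snd_pos p (prod_mono hP hQ hp)
  strictMono_fst y hy := (h.strictMono_fst y (hQ hy)).mono hP
  strictMono_snd x hx := (h.strictMono_snd x (hP hx)).mono hQ

/-- The one-dimensional inequality, by transport of both densities to the unit interval. -/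
theorem lintegral_transport_real {f g : ℝ → ℝ≥0} (hf : Measurable f) (hg : Measurable g)
    (hf0 : ∫⁻ x, (f x : ℝ≥0∞) ≠ 0) (hf1 : ∫⁻ x, (f x : ℝ≥0∞) ≠ ∞)
    (hg0 : ∫⁻ x, (g x : ℝ≥0∞) ≠ 0) (hg1 : ∫⁻ x, (g x : ℝ≥0∞) ≠ ∞)
    (h : ℝ → ℝ≥0∞) {φ φx φy : ℝ × ℝ → ℝ}
    (hφ : IsIncreasingC1On φ φx φy (Function.support f) (Function.support g))
    (Φ : ℝ≥0 → ℝ≥0 → ℝ≥0)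
    (hcond : ∀ x, f x ≠ 0 → ∀ y, g y ≠ 0 → ∀ ρ η : ℝ≥0, 0 < ρ → 0 < η →
      (Φ (f x * ρ) (g y * η) : ℝ≥0∞) ≤
        h (φ (x, y)) * ENNReal.ofReal (φx (x, y) * ρ + φy (x, y) * η)) :
    (Φ (∫⁻ x, (f x : ℝ≥0∞)).toNNReal (∫⁻ x, (g x : ℝ≥0∞)).toNNReal : ℝ≥0∞) ≤ ∫⁻ z, h z := by
  obtain ⟨u, S, hS, hS01, hS1, hfu, hu, hud⟩ := exists_quantile hf hf0 hf1
  obtain ⟨v, T, hT, hT01, hT1, hgv, hv, hvd⟩ := exists_quantile hg hg0 hg1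
  set F := (∫⁻ x, (f x : ℝ≥0∞)).toNNReal with hF
  set G := (∫⁻ x, (g x : ℝ≥0∞)).toNNReal with hG
  have hFpos : 0 < F := ENNReal.toNNReal_pos hf0 hf1
  have hGpos : 0 < G := ENNReal.toNNReal_pos hg0 hg1
  have hvol : volume (S ∩ T) = 1 := by
    have hS' : S =ᵐ[volume] Icc (0 : ℝ) 1 :=
      ae_eq_of_subset_of_measure_ge hS01 (by simp [hS1]) hS.nullMeasurableSet (by simp)
    have hT' : T =ᵐ[volume] Icc (0 : ℝ) 1 :=
      ae_eq_of_subset_of_measure_ge hT01 (by simp [hT1]) hT.nullMeasurableSet (by simp)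
    rw [measure_congr (hS'.inter hT')]
    simp
  let z : ℝ → ℝ := fun t => φ (u t, v t)
  let z' : ℝ → ℝ := fun t => φx (u t, v t) * (F / f (u t) : ℝ≥0) + φy (u t, v t) * (G / g (v t) : ℝ≥0)
  have hz : ∀ t ∈ S ∩ T, HasDerivWithinAt z (z' t) (S ∩ T) t := by
    intro t ht
    have h1 := (hud t ht.1).mono (inter_subset_left (t := T))
    have h2 := (hvd t ht.2).mono (inter_subset_right (s := S))
    have hmaps : MapsTo (fun t => (u t, v t)) (S ∩ T) (Function.support f ×ˢ Function.support g) :=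
      fun s hs => ⟨hfu s hs.1, hgv s hs.2⟩
    have h3 := (hφ.hasFDerivWithinAt (u t, v t) (hmaps ht)).comp_hasDerivWithinAt t
      (h1.prodMk h2) hmaps
    convert! h3 using 1
  have hzm : StrictMonoOn z (S ∩ T) := by
    intro s hs t ht hst
    exact (hφ.strictMono_fst _ (hgv s hs.2) (hfu s hs.1) (hfu t ht.1) (hu hs.1 ht.1 hst)).trans
      (hφ.strictMono_snd _ (hfu t ht.1) (hgv s hs.2) (hgv t ht.2) (hv hs.2 ht.2 hst))
  have key : ∀ t ∈ S ∩ T, (Φ F G : ℝ≥0∞) ≤ ENNReal.ofReal |z' t| * h (z t) := by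
    intro t ht
    have hft := hfu t ht.1
    have hgt := hgv t ht.2
    have hp : (u t, v t) ∈ Function.support f ×ˢ Function.support g := ⟨hft, hgt⟩
    -- These weights are the derivatives of u and v, so both arguments of Φ become the constants F
    -- and G.
    have := hcond (u t) hft (v t) hgt (F / f (u t)) (G / g (v t))
      (div_pos hFpos (pos_iff_ne_zero.2 hft)) (div_pos hGpos (pos_iff_ne_zero.2 hgt))
    rw [mul_div_cancel₀ _ hft, mul_div_cancel₀ _ hgt] at this
    refine this.trans_eq ?_
    rw [mul_comm, abs_of_nonneg]
    exact add_nonneg (mul_nonneg (hφ.fst_pos _ hp).le NNReal.zero_le_coe)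
      (mul_nonneg (hφ.snd_pos _ hp).le NNReal.zero_le_coe)
  calc (Φ F G : ℝ≥0∞) = ∫⁻ _ in S ∩ T, (Φ F G : ℝ≥0∞) := by simp [hvol]
    _ ≤ ∫⁻ t in S ∩ T, ENNReal.ofReal |z' t| * h (z t) :=
      setLIntegral_mono' (hS.inter hT) key
    _ = ∫⁻ y in z '' (S ∩ T), h y :=
      (lintegral_image_eq_lintegral_abs_deriv_mul (hS.inter hT) hz hzm.injOn h).symm
    _ ≤ ∫⁻ y, h y := setLIntegral_le_lintegral _ _

/-! ### Induction on the dimension. -/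

theorem measurable_finCons {n : ℕ} :
    Measurable fun p : ℝ × (Fin n → ℝ) => (Fin.cons p.1 p.2 : Fin (n + 1) → ℝ) := by
  refine measurable_pi_iff.2 (Fin.cases ?_ fun i => ?_)
  · simpa using measurable_fst
  · simpa [Function.comp_def] using (measurable_pi_apply i).comp measurable_snd

theorem lintegral_finCons {n : ℕ} {F : (Fin (n + 1) → ℝ) → ℝ≥0∞} (hF : Measurable F) :
    ∫⁻ x, F x = ∫⁻ a : ℝ, ∫⁻ x : Fin n → ℝ, F (Fin.cons a x) := by
  have hp := (volume_preserving_piFinSuccAbove (fun _ : Fin (n + 1) => ℝ) 0).symm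
  have e : ∀ p : ℝ × (Fin n → ℝ),
      (MeasurableEquiv.piFinSuccAbove (fun _ : Fin (n + 1) => ℝ) 0).symm p = Fin.cons p.1 p.2 :=
    fun p => Fin.insertNth_zero' _ _
  rw [← hp.lintegral_comp hF]
  simp_rw [e]
  exact lintegral_prod _ (hF.comp measurable_finCons).aemeasurable

/-- The inequality for measurable functions of finite nonzero integral, with the condition on `h`
stated in `[0,∞]`. -/
theorem lintegral_transport_pi (Φ : ℝ≥0 → ℝ≥0 → ℝ≥0) (n : ℕ) {f g : (Fin n → ℝ) → ℝ≥0}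
    (hf : Measurable f) (hg : Measurable g)
    (hf0 : ∫⁻ x, (f x : ℝ≥0∞) ≠ 0) (hf1 : ∫⁻ x, (f x : ℝ≥0∞) ≠ ∞)
    (hg0 : ∫⁻ x, (g x : ℝ≥0∞) ≠ 0) (hg1 : ∫⁻ x, (g x : ℝ≥0∞) ≠ ∞)
    {h : (Fin n → ℝ) → ℝ≥0∞} (hh : Measurable h) {φ φx φy : Fin n → ℝ × ℝ → ℝ}
    (hφ : ∀ k, IsIncreasingC1On (φ k) (φx k) (φy k) (coordSupport f k) (coordSupport g k))
    (hcond : ∀ x, f x ≠ 0 → ∀ y, g y ≠ 0 → ∀ ρ η : Fin n → ℝ≥0,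
      (∀ k, 0 < ρ k) → (∀ k, 0 < η k) →
      (Φ (f x * ∏ k, ρ k) (g y * ∏ k, η k) : ℝ≥0∞) ≤ h (fun k => φ k (x k, y k)) *
        ∏ k, ENNReal.ofReal (φx k (x k, y k) * ρ k + φy k (x k, y k) * η k)) :
    (Φ (∫⁻ x, (f x : ℝ≥0∞)).toNNReal (∫⁻ x, (g x : ℝ≥0∞)).toNNReal : ℝ≥0∞) ≤ ∫⁻ z, h z := by
  induction n with
  | zero =>
    have e : ∀ F : (Fin 0 → ℝ) → ℝ≥0∞, ∫⁻ x, F x = F default := fun F => by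
      rw [lintegral_unique, volume_pi, Measure.pi_of_empty _ default, measure_univ, mul_one]
      exact congrArg F (Subsingleton.elim _ _)
    simp only [e] at hf0 hg0 ⊢
    have := hcond default (by simpa using hf0) default (by simpa using hg0) 1 1 (by simp) (by simp)
    simp only [Finset.univ_eq_empty, Finset.prod_empty, mul_one] at this
    rw [ENNReal.toNNReal_coe, ENNReal.toNNReal_coe]
    convert! this
  | succ n ih =>
    -- A marginal may be infinite on a null set; `toNNReal` sets it to 0 there and preserves the
    -- integral.
    have slice : ∀ {F : (Fin (n + 1) → ℝ) → ℝ≥0}, Measurable F → ∫⁻ x, (F x : ℝ≥0∞) ≠ ∞ →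
        Measurable (fun a => (∫⁻ x, (F (Fin.cons a x) : ℝ≥0∞)).toNNReal) ∧
        ∫⁻ a, ((∫⁻ x, (F (Fin.cons a x) : ℝ≥0∞)).toNNReal : ℝ≥0∞) = ∫⁻ x, (F x : ℝ≥0∞) := by
      intro F hF hF1
      have hm : Measurable fun a => ∫⁻ x : Fin n → ℝ, (F (Fin.cons a x) : ℝ≥0∞) :=
        (hF.coe_nnreal_ennreal.comp measurable_finCons).lintegral_prod_right'
      refine ⟨hm.ennreal_toNNReal, ?_⟩
      rw [lintegral_finCons hF.coe_nnreal_ennreal] at hF1 ⊢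
      refine lintegral_congr_ae ?_
      filter_upwards [ae_lt_top hm hF1] with a ha
      exact ENNReal.coe_toNNReal ha.ne
    obtain ⟨hfs, hfi⟩ := slice hf hf1
    obtain ⟨hgs, hgi⟩ := slice hg hg1
    have hsupp : ∀ {F : (Fin (n + 1) → ℝ) → ℝ≥0},
        Function.support (fun a => (∫⁻ x, (F (Fin.cons a x) : ℝ≥0∞)).toNNReal)
          ⊆ coordSupport F 0 := by
      intro F a ha
      by_contra hcon
      refine ha ?_
      have : ∀ x : Fin n → ℝ, F (Fin.cons a x) = 0 := fun x => by
        by_contra hx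
        exact hcon ⟨Fin.cons a x, hx, rfl⟩
      simp [this]
    rw [← hfi, ← hgi, lintegral_finCons hh]
    refine lintegral_transport_real hfs hgs (by rwa [hfi]) (by rwa [hfi]) (by rwa [hgi])
      (by rwa [hgi]) _ ((hφ 0).mono hsupp hsupp) Φ ?_
    intro a ha b hb r s hr hs
    have ha' := ENNReal.toNNReal_ne_zero.1 ha
    have hb' := ENNReal.toNNReal_ne_zero.1 hb
    have scale : ∀ {F : (Fin (n + 1) → ℝ) → ℝ≥0}, Measurable F → ∀ (a : ℝ) (r : ℝ≥0),
        ∫⁻ x : Fin n → ℝ, ((F (Fin.cons a x) * r : ℝ≥0) : ℝ≥0∞)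
          = (∫⁻ x : Fin n → ℝ, (F (Fin.cons a x) : ℝ≥0∞)) * r := by
      intro F hF a r
      simp_rw [ENNReal.coe_mul]
      exact lintegral_mul_const _
        (hF.coe_nnreal_ennreal.comp (measurable_finCons.comp measurable_prodMk_left))
    have sub : ∀ {F : (Fin (n + 1) → ℝ) → ℝ≥0} (a : ℝ) (r : ℝ≥0) (k : Fin n),
        coordSupport (fun x => F (Fin.cons a x) * r) k ⊆ coordSupport F k.succ := by
      rintro F a r k _ ⟨x, hx, rfl⟩
      exact ⟨Fin.cons a x, left_ne_zero_of_mul hx, by simp⟩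
    have hslice : ∀ a : ℝ, Measurable fun x : Fin n → ℝ => (Fin.cons a x : Fin (n + 1) → ℝ) :=
      fun a => measurable_finCons.comp measurable_prodMk_left
    have hr' : (r : ℝ≥0∞) ≠ 0 := by simpa using hr.ne'
    have hs' : (s : ℝ≥0∞) ≠ 0 := by simpa using hs.ne'
    -- The first-coordinate weights r, s are absorbed into the slices and the first Jacobian factor
    -- into h.
    have key := ih (f := fun x => f (Fin.cons a x) * r) (g := fun x => g (Fin.cons b x) * s)
      (h := fun z => h (Fin.cons (φ 0 (a, b)) z) *
        ENNReal.ofReal (φx 0 (a, b) * r + φy 0 (a, b) * s))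
      (φ := fun k => φ k.succ) (φx := fun k => φx k.succ) (φy := fun k => φy k.succ)
      ((hf.comp (hslice a)).mul_const r) ((hg.comp (hslice b)).mul_const s)
      (by rw [scale hf]; exact mul_ne_zero ha'.1 hr')
      (by rw [scale hf]; exact ENNReal.mul_ne_top ha'.2 ENNReal.coe_ne_top)
      (by rw [scale hg]; exact mul_ne_zero hb'.1 hs')
      (by rw [scale hg]; exact ENNReal.mul_ne_top hb'.2 ENNReal.coe_ne_top)
      ((hh.comp (hslice _)).mul_const _)
      (fun k => (hφ k.succ).mono (sub a r k) (sub b s k))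
      (by
        intro x hx y hy ρ η hρ hη
        have := hcond (Fin.cons a x) (left_ne_zero_of_mul hx) (Fin.cons b y)
          (left_ne_zero_of_mul hy) (Fin.cons r ρ) (Fin.cons s η)
          (Fin.cases hr hρ) (Fin.cases hs hη)
        simp only [Fin.prod_univ_succ, Fin.cons_zero, Fin.cons_succ] at this
        rw [mul_assoc, mul_assoc, mul_assoc]
        convert! this using 3
        funext k
        refine Fin.cases ?_ (fun i => ?_) k <;> simp)
    have hmul := lintegral_mul_const (μ := volume)
      (ENNReal.ofReal (φx 0 (a, b) * r + φy 0 (a, b) * s)) (hh.comp (hslice (φ 0 (a, b))))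
    simp only [Function.comp_apply] at hmul
    rw [scale hf, scale hg, hmul, ENNReal.toNNReal_mul,
      ENNReal.toNNReal_mul, ENNReal.toNNReal_coe, ENNReal.toNNReal_coe] at key
    exact key

/-! ### Vanishing integrals and the general case. -/

/-- The condition on h is pointwise, so an a.e. equal version does not suffice. Setting the value ∞
on a null set gives a majorant everywhere at no cost. -/
theorem AEMeasurable.exists_measurable_ge {α : Type*} [MeasurableSpace α] {μ : Measure α}
    {h : α → ℝ≥0∞} (hh : AEMeasurable h μ) :
    ∃ H : α → ℝ≥0∞, Measurable H ∧ (∀ x, h x ≤ H x) ∧ ∫⁻ x, H x ∂μ = ∫⁻ x, h x ∂μ := by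
  obtain ⟨N, hN, hNm, hN0⟩ := exists_measurable_superset_of_null (ae_iff.1 hh.ae_eq_mk)
  refine ⟨fun x => N.indicator (fun _ => ∞) x ⊔ hh.mk h x,
    (measurable_const.indicator hNm).sup hh.measurable_mk, fun x => ?_, lintegral_congr_ae ?_⟩
  · by_cases hx : x ∈ N
    · simp [hx]
    · have : h x = hh.mk h x := by
        by_contra hcon
        exact hx (hN hcon)
      simp [this]
  · filter_upwards [measure_eq_zero_iff_ae_notMem.1 hN0, hh.ae_eq_mk] with x hx hx'
    simp [hx, hx']

/-- Change of variables under a map acting coordinatewise, with a limit `ε → 0` in the condition. -/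
theorem const_mul_lintegral_le_of_coordinatewise {n : ℕ} (g : (Fin n → ℝ) → ℝ≥0)
    (h : (Fin n → ℝ) → ℝ≥0∞) (c : ℝ≥0) (ψ a b : Fin n → ℝ → ℝ)
    (hψ : ∀ k, StrictMonoOn (ψ k) (coordSupport g k))
    (hd : ∀ k, ∀ y ∈ coordSupport g k, HasDerivWithinAt (ψ k) (b k y) (coordSupport g k) y)
    (hb : ∀ k, ∀ y ∈ coordSupport g k, 0 < b k y)
    (hc : ∀ y, g y ≠ 0 → ∀ ε : ℝ≥0, 0 < ε → ((c * g y : ℝ≥0) : ℝ≥0∞) ≤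
      h (fun k => ψ k (y k)) * ∏ k, ENNReal.ofReal (a k (y k) * ε + b k (y k))) :
    (c : ℝ≥0∞) * ∫⁻ y, (g y : ℝ≥0∞) ≤ ∫⁻ z, h z := by
  -- A measurable minorant gives a measurable domain for the change of variables.
  obtain ⟨g', hg'm, hg'le, hg'⟩ := exists_measurable_le_lintegral_eq volume fun y => (g y : ℝ≥0∞)
  have hS : MeasurableSet (Function.support g') := measurableSet_support hg'm
  have hSg : ∀ y ∈ Function.support g', g y ≠ 0 := fun y hy h0 => by
    have := hg'le y
    simp only [h0, ENNReal.coe_zero, nonpos_iff_eq_zero] at this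
    exact hy this
  have hSk : ∀ k, MapsTo (fun y : Fin n → ℝ => y k) (Function.support g') (coordSupport g k) :=
    fun k y hy => ⟨y, hSg y hy, rfl⟩
  let Ψ : (Fin n → ℝ) → Fin n → ℝ := fun y k => ψ k (y k)
  let Ψ' : (Fin n → ℝ) → (Fin n → ℝ) →L[ℝ] (Fin n → ℝ) := fun y =>
    ContinuousLinearMap.pi fun k =>
      (ContinuousLinearMap.toSpanSingleton ℝ (b k (y k))).comp (ContinuousLinearMap.proj k)
  have hΨ : ∀ y ∈ Function.support g', HasFDerivWithinAt Ψ (Ψ' y) (Function.support g') y := by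
    intro y hy
    refine hasFDerivWithinAt_pi.2 fun k => ?_
    exact (hd k _ (hSk k hy)).hasFDerivWithinAt.comp y
      (ContinuousLinearMap.proj (R := ℝ) (φ := fun _ : Fin n => ℝ) k).hasFDerivWithinAt (hSk k)
  have hinj : InjOn Ψ (Function.support g') := fun y hy y' hy' hyy' => by
    funext k
    exact (hψ k).injOn (hSk k hy) (hSk k hy') (congrFun hyy' k)
  have hdet : ∀ y ∈ Function.support g',
      ENNReal.ofReal |(Ψ' y).det| = ∏ k, ENNReal.ofReal (b k (y k)) := by
    intro y hy
    simp only [Ψ', ContinuousLinearMap.det_pi, ContinuousLinearMap.det_toSpanSingleton]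
    rw [abs_of_pos (Finset.prod_pos fun k _ => hb k _ (hSk k hy)),
      ENNReal.ofReal_prod_of_nonneg fun k _ => (hb k _ (hSk k hy)).le]
  have key : ∀ y ∈ Function.support g', (c : ℝ≥0∞) * g' y ≤ ENNReal.ofReal |(Ψ' y).det| * h (Ψ y) := by
    intro y hy
    refine (mul_le_mul_right (hg'le y) _).trans ?_
    rw [hdet y hy, mul_comm _ (h _), ← ENNReal.coe_mul]
    have hlim : Tendsto (fun ε : ℝ≥0 => ∏ k, ENNReal.ofReal (a k (y k) * ε + b k (y k))) (𝓝[>] 0)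
        (𝓝 (∏ k, ENNReal.ofReal (b k (y k)))) := by
      simp_rw [ENNReal.ofReal, ← ENNReal.ofNNReal_finsetProd]
      have hcont : Continuous fun ε : ℝ≥0 => ∏ k, (a k (y k) * ε + b k (y k)).toNNReal := by
        fun_prop
      refine ENNReal.tendsto_coe.2 (tendsto_nhdsWithin_of_tendsto_nhds ?_)
      simpa using hcont.tendsto 0
    -- A nonzero limit is needed because h may be ∞ and ∞ · 0 is a discontinuity.
    have hne : ∏ k, ENNReal.ofReal (b k (y k)) ≠ 0 :=
      Finset.prod_ne_zero_iff.2 fun k _ => (ENNReal.ofReal_pos.2 (hb k _ (hSk k hy))).ne'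
    refine ge_of_tendsto (ENNReal.Tendsto.const_mul hlim (Or.inl hne)) ?_
    filter_upwards [self_mem_nhdsWithin] with ε hε
    exact hc y (hSg y hy) ε hε
  calc (c : ℝ≥0∞) * ∫⁻ y, (g y : ℝ≥0∞) = ∫⁻ y in Function.support g', c * g' y := by
        rw [hg', ← lintegral_const_mul _ hg'm, ← lintegral_indicator hS]
        refine lintegral_congr fun y => ?_
        by_cases hy : g' y = 0 <;> simp [indicator, hy]
    _ ≤ ∫⁻ y in Function.support g', ENNReal.ofReal |(Ψ' y).det| * h (Ψ y) := setLIntegral_mono' hS key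
    _ = ∫⁻ z in Ψ '' Function.support g', h z :=
      (lintegral_image_eq_lintegral_abs_det_fderiv_mul volume hS hΨ hinj h).symm
    _ ≤ ∫⁻ z, h z := setLIntegral_le_lintegral _ _

theorem coordSupport_mono {n : ℕ} {f f' : (Fin n → ℝ) → ℝ≥0} (h : ∀ x, f' x ≤ f x) (k : Fin n) :
    coordSupport f' k ⊆ coordSupport f k :=
  image_mono fun x hx h0 => hx (le_antisymm ((h x).trans_eq h0) zero_le)

theorem ENNReal.coe_mul_lt_of_lt_one_of_le {r s : ℝ≥0} {F : ℝ≥0∞} (hr : r < 1) (hF : F ≠ 0)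
    (hs : (s : ℝ≥0∞) ≤ F) : ((r * s : ℝ≥0) : ℝ≥0∞) < F := by
  rcases eq_or_ne s 0 with rfl | hs0
  · simpa using pos_iff_ne_zero.2 hF
  · refine lt_of_lt_of_le (ENNReal.coe_lt_coe.2 ?_) hs
    exact mul_lt_of_lt_one_left (pos_iff_ne_zero.2 hs0) hr

theorem theorem1p1 (n : ℕ) (f g h : (Fin n → ℝ) → ℝ≥0)
    (hf : AEMeasurable f volume) (hg : AEMeasurable g volume) (hh : AEMeasurable h volume)
    (hf0 : (Function.support f).Nonempty) (hg0 : (Function.support g).Nonempty)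
    (φ φx φy : Fin n → ℝ × ℝ → ℝ)
    (hφ : ∀ k, IsIncreasingC1On (φ k) (φx k) (φy k) (coordSupport f k) (coordSupport g k))
    (Φ : ℝ≥0 → ℝ≥0 → ℝ≥0)
    (hΦc : Continuous fun p : ℝ≥0 × ℝ≥0 => Φ p.1 p.2)
    (hΦhom : ∀ t a b : ℝ≥0, 0 < t → Φ (t * a) (t * b) = t * Φ a b)
    (hΦ₁ : ∀ b, Monotone fun a => Φ a b) (hΦ₂ : ∀ a, Monotone fun b => Φ a b)
    (hcond : ∀ x ∈ Function.support f, ∀ y ∈ Function.support g, ∀ ρ η : Fin n → ℝ≥0,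
      (∀ k, 0 < ρ k) → (∀ k, 0 < η k) →
        (Φ (f x * ∏ k, ρ k) (g y * ∏ k, η k) : ℝ) ≤
          (h fun k => φ k (x k, y k) : ℝ) *
            ∏ k, (φx k (x k, y k) * (ρ k : ℝ) + φy k (x k, y k) * (η k : ℝ))) :
    extendTop Φ (∫⁻ x, (f x : ℝ≥0∞)) (∫⁻ y, (g y : ℝ≥0∞)) ≤ ∫⁻ z, (h z : ℝ≥0∞) := by
  obtain ⟨H, hH, hhH, hHint⟩ := hh.coe_nnreal_ennreal.exists_measurable_ge
  rw [← hHint]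
  have mono : ∀ {a a' b b' : ℝ≥0}, a ≤ a' → b ≤ b' → Φ a b ≤ Φ a' b' :=
    fun ha hb => (hΦ₁ _ ha).trans (hΦ₂ _ hb)
  have hom : ∀ t a b : ℝ≥0, Φ (t * a) (t * b) = t * Φ a b := by
    intro t a b
    rcases eq_or_ne t 0 with rfl | ht
    -- Scaling by 2 gives Φ(0, 0) = 2 Φ(0, 0), hence Φ(0, 0) = 0.
    · have h2 := hΦhom 2 0 0 two_pos
      rw [mul_zero, two_mul, left_eq_add] at h2
      simp [h2]
    · exact hΦhom t a b (pos_iff_ne_zero.2 ht)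
  have hmem : ∀ {x y}, f x ≠ 0 → g y ≠ 0 → ∀ k,
      (x k, y k) ∈ coordSupport f k ×ˢ coordSupport g k :=
    fun hx hy k => ⟨⟨_, hx, rfl⟩, ⟨_, hy, rfl⟩⟩
  have cond : ∀ x, f x ≠ 0 → ∀ y, g y ≠ 0 → ∀ ρ η : Fin n → ℝ≥0,
      (∀ k, 0 < ρ k) → (∀ k, 0 < η k) →
      (Φ (f x * ∏ k, ρ k) (g y * ∏ k, η k) : ℝ≥0∞) ≤ H (fun k => φ k (x k, y k)) *
        ∏ k, ENNReal.ofReal (φx k (x k, y k) * ρ k + φy k (x k, y k) * η k) := by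
    intro x hx y hy ρ η hρ hη
    have h1 := ENNReal.ofReal_le_ofReal (hcond x hx y hy ρ η hρ hη)
    rw [ENNReal.ofReal_coe_nnreal, ENNReal.ofReal_mul NNReal.zero_le_coe,
      ENNReal.ofReal_coe_nnreal, ENNReal.ofReal_prod_of_nonneg] at h1
    · exact h1.trans (mul_le_mul_left (hhH _) _)
    · intro k _
      exact add_nonneg (mul_nonneg ((hφ k).fst_pos _ (hmem hx hy k)).le NNReal.zero_le_coe)
        (mul_nonneg ((hφ k).snd_pos _ (hmem hx hy k)).le NNReal.zero_le_coe)
  refine iSup₂_le fun s t => iSup₂_le fun hs ht => ?_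
  by_cases hF : ∫⁻ x, (f x : ℝ≥0∞) = 0
  · obtain ⟨x, hx⟩ := hf0
    have hs0 : s = 0 := by simpa [hF] using hs
    have hmk : ∀ k, x k ∈ coordSupport f k := fun k => ⟨x, hx, rfl⟩
    have hle := const_mul_lintegral_le_of_coordinatewise g H (Φ 0 1)
      (fun k y => φ k (x k, y)) (fun k y => φx k (x k, y)) (fun k y => φy k (x k, y))
      (fun k => (hφ k).strictMono_snd _ (hmk k))
      (fun k y hy => by
        have hmaps : MapsTo (fun y => (x k, y)) (coordSupport g k)
            (coordSupport f k ×ˢ coordSupport g k) := fun z hz => ⟨hmk k, hz⟩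
        have := ((hφ k).hasFDerivWithinAt _ (hmaps hy)).comp_hasDerivWithinAt y
          ((hasDerivWithinAt_const y _ (x k)).prodMk (hasDerivWithinAt_id y _)) hmaps
        convert! this using 1
        simp)
      (fun k y hy => (hφ k).snd_pos _ ⟨hmk k, hy⟩)
      (fun y hy ε hε => by
        have := cond x hx y hy (fun _ => ε) 1 (fun _ => hε) (by simp)
        simp only [Pi.one_apply, Finset.prod_const_one, mul_one, NNReal.coe_one] at this
        refine le_trans (ENNReal.coe_le_coe.2 ?_) this
        rw [mul_comm, ← hom, mul_zero, mul_one]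
        exact mono zero_le le_rfl)
    calc (Φ s t : ℝ≥0∞) = Φ 0 1 * t := by
          rw [hs0, ← ENNReal.coe_mul, mul_comm, ← hom, mul_zero, mul_one]
      _ ≤ Φ 0 1 * ∫⁻ y, (g y : ℝ≥0∞) := by gcongr
      _ ≤ _ := hle
  by_cases hG : ∫⁻ y, (g y : ℝ≥0∞) = 0
  · obtain ⟨y, hy⟩ := hg0
    have ht0 : t = 0 := by simpa [hG] using ht
    have hmk : ∀ k, y k ∈ coordSupport g k := fun k => ⟨y, hy, rfl⟩
    have hle := const_mul_lintegral_le_of_coordinatewise f H (Φ 1 0)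
      (fun k x => φ k (x, y k)) (fun k x => φy k (x, y k)) (fun k x => φx k (x, y k))
      (fun k => (hφ k).strictMono_fst _ (hmk k))
      (fun k x hx => by
        have hmaps : MapsTo (fun x => (x, y k)) (coordSupport f k)
            (coordSupport f k ×ˢ coordSupport g k) := fun z hz => ⟨hz, hmk k⟩
        have := ((hφ k).hasFDerivWithinAt _ (hmaps hx)).comp_hasDerivWithinAt x
          ((hasDerivWithinAt_id x _).prodMk (hasDerivWithinAt_const x _ (y k))) hmaps
        convert! this using 1
        simp)
      (fun k x hx => (hφ k).fst_pos _ ⟨hx, hmk k⟩)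
      (fun x hx ε hε => by
        have := cond x hx y hy 1 (fun _ => ε) (by simp) (fun _ => hε)
        simp only [Pi.one_apply, Finset.prod_const_one, mul_one, NNReal.coe_one] at this
        simp_rw [add_comm (φx _ _)] at this
        refine le_trans (ENNReal.coe_le_coe.2 ?_) this
        rw [mul_comm, ← hom, mul_zero, mul_one]
        exact mono le_rfl zero_le)
    calc (Φ s t : ℝ≥0∞) = Φ 1 0 * s := by
          rw [ht0, ← ENNReal.coe_mul, mul_comm, ← hom, mul_zero, mul_one]
      _ ≤ Φ 1 0 * ∫⁻ x, (f x : ℝ≥0∞) := by gcongr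
      _ ≤ _ := hle
  -- Shrinking by r < 1 leaves room for simple functions below f and g with finite integrals above r
  -- s and r t; homogeneity turns Φ(r s, r t) into r Φ(s, t).
  refine ENNReal.le_of_forall_lt_one_mul_le fun r hr => ?_
  lift r to ℝ≥0 using hr.ne_top
  have hr1 : r < 1 := by exact_mod_cast hr
  obtain ⟨f', hf'le, hf'top, hf'lt⟩ := exists_lt_lintegral_simpleFunc_of_lt_lintegral
    (ENNReal.coe_mul_lt_of_lt_one_of_le hr1 hF hs)
  obtain ⟨g', hg'le, hg'top, hg'lt⟩ := exists_lt_lintegral_simpleFunc_of_lt_lintegral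
    (ENNReal.coe_mul_lt_of_lt_one_of_le hr1 hG ht)
  have hne : ∀ {a b : ℝ≥0}, a ≤ b → a ≠ 0 → b ≠ 0 := fun hab ha hb =>
    ha (le_antisymm (hab.trans_eq hb) zero_le)
  rw [← ENNReal.coe_mul, ← hom]
  refine le_trans (ENNReal.coe_le_coe.2 (mono ?_ ?_))
    (lintegral_transport_pi Φ n f'.measurable g'.measurable (ne_bot_of_gt hf'lt) hf'top.ne
      (ne_bot_of_gt hg'lt) hg'top.ne hH
      (fun k => (hφ k).mono (coordSupport_mono hf'le k) (coordSupport_mono hg'le k))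
      fun x hx y hy ρ η hρ hη => le_trans (ENNReal.coe_le_coe.2 (mono ?_ ?_))
        (cond x (hne (hf'le x) hx) y (hne (hg'le y) hy) ρ η hρ hη))
  · exact (ENNReal.le_toNNReal_of_coe_le hf'lt.le hf'top.ne)
  · exact (ENNReal.le_toNNReal_of_coe_le hg'lt.le hg'top.ne)
  · exact mul_le_mul_left (hf'le x) _
  · exact mul_le_mul_left (hg'le y) _
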